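/- A function $\varphi:\mathbb R\to\mathbb R$ is called a Young function if it is continuous, convex and even, $\varphi(x)=0$ exactly for $x=0$, and $\varphi(x)/x\to\infty$ and $\varphi(x)\to\infty$ as $x\to\infty$. It satisfies $\Delta_2$ if there are $k>0$ and $x_0>0$ with $\varphi(2x)\le k\varphi(x)$ for all $x\ge x_0$. For a finite measure space $(\Omega,\mathcal A,\mu)$, the Orlicz space $L^\varphi(\mathcal A)$ is the space of $\mathcal A$-measurable $f:\Omega\to\mathbb R$ with $\int_\Omega\varphi(\alpha f)\,d\mu<\infty$ for some $\alpha>0$ (functions equal a.e. being identified), with the norm $N_\varphi(f)=\inf\{k>0:\int_\Omega\varphi(|f|/k)\,d\mu\le 1\}$. **Theorem.** Let $(\Omega,\mathcal A,\mu)$ be a finite measure space, let $\varphi$ be a Young function satisfying $\Delta_2$, and let $(\mathcal A_n)_{n\in\mathbb N}$ and $\mathfrak D$ be $\sigma$-subalgebras of $\mathcal A$. Then the following are equivalent. 1. $\mathcal A_n$ $\mu\perp$-converges to $\mathfrak D$, that is, both - ($\mu$-convergence) for every $D\in\mathfrak D$ there are sets $A_n\in\mathcal A_n$ with $\mu(A_n\triangle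 D)\to 0$; and - (orthogonal convergence) for every sequence of sets $A_n\in\mathcal A_n$, the functions $\chi_{A_n}-E(\chi_{A_n}\mid\mathfrak D)$ converge to $0$ weakly in $L^\varphi(\mathcal A)$, i.e. $\ell\bigl(\chi_{A_n}-E(\chi_{A_n}\mid\mathfrak D)\bigr)\to 0$ for every bounded linear functional $\ell$ on $(L^\varphi(\mathcal A),N_\varphi)$. 2. For every $f\in L^\varphi(\mathcal A)$, the functions $E(f\mid\mathcal A_n)$ and $E(f\mid\mathfrak D)$ belong to $L^\varphi(\mathcal A)$ and $N_\varphi\bigl(E(f\mid\mathcal A_n)-E(f\mid\mathfrak D)\bigr)\to 0$. -/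

import Mathlib

open MeasureTheory Filter Topology

/-- A Young function: a continuous, convex, even function `ℝ → ℝ` that vanishes exactly at `0`,
with `φ x / x → ∞` and `φ x → ∞` as `x → ∞`. -/
structure IsYoungFunction (φ : ℝ → ℝ) : Prop where
  continuous : Continuous φ
  convexOn : ConvexOn ℝ Set.univ φ
  eq_zero_iff : ∀ x, φ x = 0 ↔ x = 0
  even : ∀ x, φ (-x) = φ x
  tendsto_div : Tendsto (fun x => φ x / x) atTop atTop
  tendsto_atTop : Tendsto φ atTop atTop

/-- The `Δ₂`-condition (for large arguments). -/
def SatisfiesDeltaTwo (φ : ℝ → ℝ) : Prop :=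
  ∃ k : ℝ, 0 < k ∧ ∃ x₀ : ℝ, 0 < x₀ ∧ ∀ x, x₀ ≤ x → φ (2 * x) ≤ k * φ x

theorem IsYoungFunction.map_zero {φ : ℝ → ℝ} (hφ : IsYoungFunction φ) : φ 0 = 0 :=
  (hφ.eq_zero_iff 0).2 rfl

theorem IsYoungFunction.nonneg {φ : ℝ → ℝ} (hφ : IsYoungFunction φ) (x : ℝ) : 0 ≤ φ x := by
  have h := hφ.convexOn.2 (Set.mem_univ x) (Set.mem_univ (-x))
    (by norm_num : (0 : ℝ) ≤ 1 / 2) (by norm_num : (0 : ℝ) ≤ 1 / 2) (by norm_num)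
  simp only [smul_eq_mul, hφ.even] at h
  rw [show (1 / 2 : ℝ) * x + 1 / 2 * -x = 0 by ring, hφ.map_zero] at h
  linarith

theorem IsYoungFunction.map_mul_le {φ : ℝ → ℝ} (hφ : IsYoungFunction φ) {t : ℝ}
    (h0 : 0 ≤ t) (h1 : t ≤ 1) (x : ℝ) : φ (t * x) ≤ φ x := by
  have h := hφ.convexOn.2 (Set.mem_univ x) (Set.mem_univ 0) h0 (sub_nonneg.2 h1) (by ring)
  simp only [smul_eq_mul, mul_zero, add_zero, hφ.map_zero] at h
  nlinarith [hφ.nonneg x]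

section

variable {Ω : Type*}

/-- The Orlicz space `L^φ(Ω, 𝒜, μ)`: the measurable functions `f : Ω → ℝ` such that
`∫ φ(α f) dμ < ∞` for some `α > 0` (recall that `φ ≥ 0`). As usual, functions that agree
almost everywhere are thought of as equal. -/
def orliczSpace [MeasurableSpace Ω] {φ : ℝ → ℝ} (hφ : IsYoungFunction φ) (μ : Measure Ω) :
    Submodule ℝ (Ω → ℝ) where
  carrier := {f | Measurable f ∧
    ∃ α : ℝ, 0 < α ∧ ∫⁻ x, ENNReal.ofReal (φ (α * f x)) ∂μ < ⊤}
  zero_mem' := ⟨measurable_const, 1, one_pos, by simp [hφ.map_zero]⟩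
  add_mem' := by
    rintro f g ⟨hf, α, hα, hfα⟩ ⟨hg, β, hβ, hgβ⟩
    refine ⟨hf.add hg, min α β / 2, by positivity, ?_⟩
    have hle : ∀ x, ENNReal.ofReal (φ (min α β / 2 * (f + g) x)) ≤
        ENNReal.ofReal (φ (α * f x)) + ENNReal.ofReal (φ (β * g x)) := by
      intro x
      rw [← ENNReal.ofReal_add (hφ.nonneg _) (hφ.nonneg _)]
      apply ENNReal.ofReal_le_ofReal
      have h := hφ.convexOn.2 (Set.mem_univ (min α β * f x)) (Set.mem_univ (min α β * g x))
        (by norm_num : (0 : ℝ) ≤ 1 / 2) (by norm_num : (0 : ℝ) ≤ 1 / 2) (by norm_num)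
      simp only [smul_eq_mul] at h
      have e : min α β / 2 * (f + g) x =
          1 / 2 * (min α β * f x) + 1 / 2 * (min α β * g x) := by
        simp only [Pi.add_apply]; ring
      have hm : 0 < min α β := lt_min hα hβ
      have h1 := hφ.map_mul_le (t := min α β / α) (by positivity)
        ((div_le_one hα).2 (min_le_left _ _)) (α * f x)
      have h2 := hφ.map_mul_le (t := min α β / β) (by positivity)
        ((div_le_one hβ).2 (min_le_right _ _)) (β * g x)
      rw [← mul_assoc, div_mul_cancel₀ _ hα.ne'] at h1
      rw [← mul_assoc, div_mul_cancel₀ _ hβ.ne'] at h2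
      rw [e]
      linarith [hφ.nonneg (α * f x), hφ.nonneg (β * g x)]
    refine (lintegral_mono hle).trans_lt ?_
    have hmeas : Measurable fun x => ENNReal.ofReal (φ (α * f x)) :=
      (hφ.continuous.measurable.comp (hf.const_mul α)).ennreal_ofReal
    rw [lintegral_add_left hmeas]
    exact ENNReal.add_lt_top.2 ⟨hfα, hgβ⟩
  smul_mem' := by
    rintro c f ⟨hf, α, hα, hfα⟩
    refine ⟨hf.const_smul c, α / (|c| + 1), by positivity, ?_⟩
    refine (lintegral_mono fun x => ?_).trans_lt hfα
    apply ENNReal.ofReal_le_ofReal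
    have hev : ∀ y, φ |y| = φ y := fun y => by
      rcases abs_choice y with h | h <;> rw [h]
      exact hφ.even y
    have h := hφ.map_mul_le (t := |c| / (|c| + 1)) (by positivity)
      ((div_le_one (by positivity)).2 (by linarith)) |α * f x|
    rw [hev] at h
    rw [← hev]
    refine le_trans (le_of_eq ?_) h
    congr 1
    simp only [Pi.smul_apply, smul_eq_mul, abs_mul, abs_div, abs_of_pos hα,
      abs_of_pos (by positivity : 0 < |c| + 1)]
    ring

/-- The (Luxemburg) norm `N_φ(f) = inf {k > 0 : ∫ φ(|f| / k) dμ ≤ 1}`. It is used only for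
members of the Orlicz space, for which the set on the right is not empty. -/
noncomputable def orliczNorm [MeasurableSpace Ω] (φ : ℝ → ℝ) (μ : Measure Ω) (f : Ω → ℝ) : ℝ :=
  sInf {k : ℝ | 0 < k ∧ ∫⁻ x, ENNReal.ofReal (φ (|f x| / k)) ∂μ ≤ 1}

/-- Norm convergence `u n → v` in the Orlicz space. -/
def OrliczTendsto [MeasurableSpace Ω] {φ : ℝ → ℝ} (hφ : IsYoungFunction φ) (μ : Measure Ω)
    (u : ℕ → Ω → ℝ) (v : Ω → ℝ) : Prop :=
  (∀ n, u n ∈ orliczSpace hφ μ) ∧ v ∈ orliczSpace hφ μ ∧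
    Tendsto (fun n => orliczNorm φ μ (u n - v)) atTop (𝓝 0)

/-- Weak convergence `u n → v` in the Orlicz space: `ℓ (u n) → ℓ v` for every bounded linear
functional `ℓ` on it. (Boundedness with respect to `N_φ` forces `ℓ` to be compatible with
almost everywhere equality.) -/
def OrliczWeakTendsto [MeasurableSpace Ω] {φ : ℝ → ℝ} (hφ : IsYoungFunction φ) (μ : Measure Ω)
    (u : ℕ → Ω → ℝ) (v : Ω → ℝ) : Prop :=
  ∃ (hu : ∀ n, u n ∈ orliczSpace hφ μ) (hv : v ∈ orliczSpace hφ μ),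
    ∀ ℓ : orliczSpace hφ μ →ₗ[ℝ] ℝ,
      (∃ C : ℝ, ∀ f : orliczSpace hφ μ, |ℓ f| ≤ C * orliczNorm φ μ f) →
        Tendsto (fun n => ℓ ⟨u n, hu n⟩) atTop (𝓝 (ℓ ⟨v, hv⟩))

/-- The orthogonal complement `f - E(f | 𝔇)` of the conditional expectation. -/
noncomputable def condExpPerp (𝔇 : MeasurableSpace Ω) [MeasurableSpace Ω] (μ : Measure Ω)
    (f : Ω → ℝ) : Ω → ℝ :=
  f - μ[f|𝔇]

/-- `μ`-convergence of a sequence of `σ`-subalgebras. -/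
def MuConverges (𝒜 : ℕ → MeasurableSpace Ω) (𝔇 : MeasurableSpace Ω) [MeasurableSpace Ω]
    (μ : Measure Ω) : Prop :=
  ∀ D : Set Ω, MeasurableSet[𝔇] D →
    ∃ A : ℕ → Set Ω, (∀ n, MeasurableSet[𝒜 n] (A n)) ∧
      Tendsto (fun n => μ (symmDiff (A n) D)) atTop (𝓝 0)

/-- Orthogonal convergence of a sequence of `σ`-subalgebras in the Orlicz space. -/
def PerpConverges (𝒜 : ℕ → MeasurableSpace Ω) (𝔇 : MeasurableSpace Ω) [MeasurableSpace Ω]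
    {φ : ℝ → ℝ} (hφ : IsYoungFunction φ) (μ : Measure Ω) : Prop :=
  ∀ A : ℕ → Set Ω, (∀ n, MeasurableSet[𝒜 n] (A n)) →
    OrliczWeakTendsto hφ μ
      (fun n => condExpPerp 𝔇 μ ((A n).indicator fun _ => (1 : ℝ))) 0

/-- `μ⊥`-convergence: both `μ`-convergence and orthogonal convergence. -/
def MuPerpConverges (𝒜 : ℕ → MeasurableSpace Ω) (𝔇 : MeasurableSpace Ω) [MeasurableSpace Ω]
    {φ : ℝ → ℝ} (hφ : IsYoungFunction φ) (μ : Measure Ω) : Prop :=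
  MuConverges 𝒜 𝔇 μ ∧ PerpConverges 𝒜 𝔇 hφ μ

end

/-!
Both conditions are equivalent to convergence of the conditional expectations in `L¹`:
`∫ |E(f | 𝒜 n) - E(f | 𝔇)| dμ → 0` for every integrable `f`. Since conditional expectations contract
`L¹`, it is enough to know this for bounded `f`
(`tendsto_condExpL1Dist_of_forall_bounded`).

*`μ⊥`-convergence and `L¹`-convergence.* For bounded `f` write `f = w + E(f | 𝔇)`. The
`μ`-convergence gives `E(h | 𝒜 n) → h` first for indicators of sets of `𝔇`, then for every
`𝔇`-measurable integrable `h`, in particular for `h = E(f | 𝔇)`. Orthogonal convergence, tested on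
the functional `u ↦ ∫ u w dμ`, says that `∫_{A n} w dμ → 0` whenever `A n ∈ 𝒜 n`; taking for `A n`
the set where `E(w | 𝒜 n) ≥ 0` and its complement gives `E(w | 𝒜 n) → 0` in `L¹`
(`MuPerpConverges.tendsto_condExpL1Dist`). Conversely, `μ`-convergence follows from `L¹`-convergence
for `f = χ_D` and Markov's inequality (`muConverges_of_tendsto_condExpL1Dist`). For orthogonal
convergence no description of the dual space is needed: for a bounded functional `ℓ` the set
function `ν(A) = ℓ(χ_A - E(χ_A | 𝔇))` is a signed measure, absolutely continuous with respect to `μ`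
and zero on `𝔇`. Its Radon-Nikodym density `g` satisfies `E(g | 𝔇) = 0`, whence
`|ν(A n)| ≤ ∫ |E(g | 𝒜 n) - E(g | 𝔇)| dμ → 0` (`perpConverges_of_tendsto_condExpL1Dist`).

*Norm convergence and `L¹`-convergence.* The Orlicz norm dominates the `L¹`-norm, since `φ` grows
faster than linearly (`exists_integral_abs_le_mul_orliczNorm`). Conversely, for uniformly bounded
functions `L¹`-convergence implies convergence in the Orlicz norm
(`tendsto_orliczModular_of_bounded`); under `Δ₂` bounded functions are dense in the Orlicz space
(`exists_bounded_orliczModular_sub_lt`), and conditional expectations do not increase the modular, by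
Jensen's inequality (`orliczModular_condExp_le`). These combine in `orliczTendsto_condExp`.
-/

/-! ### Young functions -/

namespace IsYoungFunction

variable {φ : ℝ → ℝ}

theorem map_abs (hφ : IsYoungFunction φ) (x : ℝ) : φ |x| = φ x := by
  rcases abs_choice x with h | h <;> rw [h]
  exact hφ.even x

theorem map_mul_le_mul (hφ : IsYoungFunction φ) {t : ℝ} (h0 : 0 ≤ t) (h1 : t ≤ 1) (x : ℝ) :
    φ (t * x) ≤ t * φ x := by
  have h := hφ.convexOn.2 (Set.mem_univ x) (Set.mem_univ 0) h0 (sub_nonneg.2 h1) (by ring)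
  simpa only [smul_eq_mul, mul_zero, add_zero, hφ.map_zero] using h

theorem map_le_map_of_abs_le (hφ : IsYoungFunction φ) {x y : ℝ} (h : |x| ≤ |y|) : φ x ≤ φ y := by
  rcases eq_or_ne y 0 with rfl | hy
  · have : x = 0 := by simpa using h
    rw [this]
  · have hy' : 0 < |y| := abs_pos.2 hy
    have := hφ.map_mul_le (t := |x| / |y|) (by positivity) ((div_le_one hy').2 h) |y|
    rwa [div_mul_cancel₀ _ hy'.ne', hφ.map_abs, hφ.map_abs] at this

theorem exists_abs_le_add (hφ : IsYoungFunction φ) : ∃ c : ℝ, 0 ≤ c ∧ ∀ x, |x| ≤ c + φ x := by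
  obtain ⟨c, hc⟩ := eventually_atTop.1 (hφ.tendsto_div.eventually_ge_atTop 1)
  refine ⟨max c 0, le_max_right _ _, fun x => ?_⟩
  rcases le_total |x| (max c 0) with h | h
  · linarith [hφ.nonneg x]
  · rcases (abs_nonneg x).eq_or_lt with h0 | h0
    · rw [← h0]
      have := hφ.nonneg x
      positivity
    · have := hc |x| ((le_max_left _ _).trans h)
      rw [le_div_iff₀ h0, hφ.map_abs] at this
      linarith [le_max_right c 0]

theorem map_add_add_le (hφ : IsYoungFunction φ) (a b c : ℝ) :
    φ (a + b + c) ≤ φ (3 * a) + φ (3 * b) + φ (3 * c) := by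
  -- A sum of three terms is at most three times the largest one.
  have hle : |a + b + c| ≤ |a| + |b| + |c| := abs_add_three a b c
  have ha := hφ.nonneg (3 * a)
  have hb := hφ.nonneg (3 * b)
  have hc := hφ.nonneg (3 * c)
  have key : ∀ y, |a| ≤ |y| → |b| ≤ |y| → |c| ≤ |y| → φ (a + b + c) ≤ φ (3 * y) := by
    intro y h1 h2 h3
    apply hφ.map_le_map_of_abs_le
    rw [abs_mul, abs_of_pos (by norm_num : (0 : ℝ) < 3)]
    linarith
  rcases le_total |a| |b| with h1 | h1
  · rcases le_total |b| |c| with h2 | h2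
    · linarith [key c (h1.trans h2) h2 le_rfl]
    · linarith [key b h1 le_rfl h2]
  · rcases le_total |a| |c| with h2 | h2
    · linarith [key c h2 (h1.trans h2) le_rfl]
    · linarith [key a le_rfl h1 h2]

/-- The `Δ₂`-condition, which concerns dilation by `2` of large arguments, controls every
dilation of every argument, at the cost of an additive constant. -/
theorem exists_map_mul_le (hφ : IsYoungFunction φ) (hΔ : SatisfiesDeltaTwo φ) (c : ℝ) :
    ∃ K C : ℝ, 0 ≤ K ∧ 0 ≤ C ∧ ∀ x, φ (c * x) ≤ K * φ x + C := by
  obtain ⟨k, hk, x₀, hx₀, h⟩ := hΔ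
  have two : ∀ x, φ (2 * x) ≤ k * φ x + φ (2 * x₀) := by
    intro x
    rcases le_total x₀ |x| with hx | hx
    · have := h |x| hx
      rw [hφ.map_abs, ← hφ.map_abs, abs_mul, abs_abs, ← abs_mul, hφ.map_abs] at this
      linarith [hφ.nonneg (2 * x₀)]
    · have : φ (2 * x) ≤ φ (2 * x₀) := by
        apply hφ.map_le_map_of_abs_le
        rw [abs_mul, abs_mul, abs_of_pos hx₀]
        gcongr
      have := mul_nonneg hk.le (hφ.nonneg x)
      linarith
  have pow : ∀ m : ℕ, ∃ K C : ℝ, 0 ≤ K ∧ 0 ≤ C ∧ ∀ x, φ (2 ^ m * x) ≤ K * φ x + C := by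
    intro m
    induction m with
    | zero => exact ⟨1, 0, by simp, by simp, fun x => by simp⟩
    | succ m ih =>
      obtain ⟨K, C, hK, hC, ih⟩ := ih
      refine ⟨k * K, k * C + φ (2 * x₀), by positivity,
        add_nonneg (by positivity) (hφ.nonneg _), fun x => ?_⟩
      calc φ (2 ^ (m + 1) * x) = φ (2 * (2 ^ m * x)) := by ring_nf
        _ ≤ k * φ (2 ^ m * x) + φ (2 * x₀) := two _
        _ ≤ k * (K * φ x + C) + φ (2 * x₀) := by gcongr; exact ih x
        _ = k * K * φ x + (k * C + φ (2 * x₀)) := by ring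
  obtain ⟨m, hm⟩ := pow_unbounded_of_one_lt |c| (one_lt_two (α := ℝ))
  obtain ⟨K, C, hK, hC, hle⟩ := pow m
  refine ⟨K, C, hK, hC, fun x => (hφ.map_le_map_of_abs_le ?_).trans (hle x)⟩
  rw [abs_mul, abs_mul, abs_of_pos (by positivity : (0 : ℝ) < 2 ^ m)]
  gcongr

end IsYoungFunction

/-! ### The modular of an Orlicz space -/

section Modular

variable {Ω : Type*} [mΩ : MeasurableSpace Ω] {φ : ℝ → ℝ} {μ : Measure Ω}

/-- The modular `∫ φ(f) dμ` of the Orlicz space, with values in `[0, ∞]`. -/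
noncomputable def orliczModular (φ : ℝ → ℝ) (μ : Measure Ω) (f : Ω → ℝ) : ENNReal :=
  ∫⁻ x, ENNReal.ofReal (φ (f x)) ∂μ

theorem orliczModular_congr_ae {f g : Ω → ℝ} (h : f =ᵐ[μ] g) :
    orliczModular φ μ f = orliczModular φ μ g :=
  lintegral_congr_ae (h.mono fun x hx => by simp only [hx])

theorem IsYoungFunction.measurable_ofReal_comp (hφ : IsYoungFunction φ) {f : Ω → ℝ}
    (hf : Measurable f) : Measurable fun x => ENNReal.ofReal (φ (f x)) :=
  (hφ.continuous.measurable.comp hf).ennreal_ofReal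

theorem orliczNorm_nonneg (f : Ω → ℝ) : 0 ≤ orliczNorm φ μ f :=
  Real.sInf_nonneg fun _ hk => hk.1.le

theorem lintegral_div_eq_orliczModular (hφ : IsYoungFunction φ) (f : Ω → ℝ) {k : ℝ} (hk : 0 < k) :
    ∫⁻ x, ENNReal.ofReal (φ (|f x| / k)) ∂μ = orliczModular φ μ (k⁻¹ • f) := by
  refine lintegral_congr fun x => ?_
  rw [← hφ.map_abs ((k⁻¹ • f) x), Pi.smul_apply, smul_eq_mul, abs_mul, abs_inv, abs_of_pos hk,
    div_eq_inv_mul]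

theorem orliczNorm_le (hφ : IsYoungFunction φ) {f : Ω → ℝ} {k : ℝ} (hk : 0 < k)
    (h : orliczModular φ μ (k⁻¹ • f) ≤ 1) : orliczNorm φ μ f ≤ k :=
  csInf_le ⟨0, fun _ hk => hk.1.le⟩ ⟨hk, by rwa [lintegral_div_eq_orliczModular hφ f hk]⟩

theorem tendsto_orliczNorm_zero (hφ : IsYoungFunction φ) {ι : Type*} {l : Filter ι}
    {u : ι → Ω → ℝ} (h : ∀ c : ℝ, ∀ᶠ i in l, orliczModular φ μ (c • u i) ≤ 1) :
    Tendsto (fun i => orliczNorm φ μ (u i)) l (𝓝 0) := by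
  rw [Metric.tendsto_nhds]
  intro ε hε
  filter_upwards [h (ε / 2)⁻¹] with i hi
  have := orliczNorm_le hφ (half_pos hε) hi
  rw [Real.dist_eq, sub_zero, abs_of_nonneg (orliczNorm_nonneg _)]
  linarith

theorem orliczNorm_eq_zero_of_ae (hφ : IsYoungFunction φ) {f : Ω → ℝ} (h : f =ᵐ[μ] 0) :
    orliczNorm φ μ f = 0 := by
  have : Tendsto (fun _ : ℕ => orliczNorm φ μ f) atTop (𝓝 0) := by
    refine tendsto_orliczNorm_zero hφ fun c => Eventually.of_forall fun _ => ?_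
    have hc : c • f =ᵐ[μ] fun _ => 0 := h.mono fun x hx => by simp [hx]
    rw [orliczModular_congr_ae hc]
    simp [orliczModular, hφ.map_zero]
  exact tendsto_nhds_unique tendsto_const_nhds this

/-- A bounded functional is compatible with equality almost everywhere. -/
theorem map_eq_of_ae_eq_of_bounded {hφ : IsYoungFunction φ}
    {ℓ : orliczSpace hφ μ →ₗ[ℝ] ℝ} {C : ℝ}
    (hℓ : ∀ f : orliczSpace hφ μ, |ℓ f| ≤ C * orliczNorm φ μ f) {f g : orliczSpace hφ μ}
    (h : (f : Ω → ℝ) =ᵐ[μ] g) : ℓ f = ℓ g := by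
  have h0 : ((f - g : orliczSpace hφ μ) : Ω → ℝ) =ᵐ[μ] 0 := by
    filter_upwards [h] with x hx
    simp [hx]
  have := hℓ (f - g)
  rw [orliczNorm_eq_zero_of_ae hφ h0, mul_zero, map_sub] at this
  exact sub_eq_zero.1 (abs_nonpos_iff.1 this)

/-- Every member of the Orlicz space has a multiple of modular at most `1`, so that its norm is
not an infimum over the empty set. -/
theorem exists_orliczModular_le_one {hφ : IsYoungFunction φ} {f : Ω → ℝ}
    (hf : f ∈ orliczSpace hφ μ) : ∃ k : ℝ, 0 < k ∧ orliczModular φ μ (k⁻¹ • f) ≤ 1 := by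
  obtain ⟨_, α, hα, hI⟩ := hf
  set I := ∫⁻ x, ENNReal.ofReal (φ (α * f x)) ∂μ
  have ht : 0 < 1 / (I.toReal + 1) := by positivity
  refine ⟨(1 / (I.toReal + 1) * α)⁻¹, by positivity, ?_⟩
  rw [inv_inv]
  calc orliczModular φ μ ((1 / (I.toReal + 1) * α) • f)
      ≤ ∫⁻ x, ENNReal.ofReal (1 / (I.toReal + 1)) * ENNReal.ofReal (φ (α * f x)) ∂μ := by
        refine lintegral_mono fun x => ?_
        rw [← ENNReal.ofReal_mul ht.le]
        apply ENNReal.ofReal_le_ofReal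
        rw [Pi.smul_apply, smul_eq_mul, mul_assoc]
        exact hφ.map_mul_le_mul ht.le
          ((div_le_one (by positivity)).2 (by linarith [ENNReal.toReal_nonneg (a := I)])) _
    _ = ENNReal.ofReal (1 / (I.toReal + 1)) * I := lintegral_const_mul' _ _ ENNReal.ofReal_ne_top
    _ = ENNReal.ofReal (1 / (I.toReal + 1) * I.toReal) := by
        rw [ENNReal.ofReal_mul ht.le, ENNReal.ofReal_toReal hI.ne]
    _ ≤ 1 := by
        rw [ENNReal.ofReal_le_one, one_div_mul_eq_div, div_le_one (by positivity)]
        linarith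

variable [IsFiniteMeasure μ]

/-- The Orlicz space of a finite measure embeds continuously into `L¹`. -/
theorem exists_integral_abs_le_mul_orliczNorm (hφ : IsYoungFunction φ) (μ : Measure Ω)
    [IsFiniteMeasure μ] : ∃ C : ℝ, ∀ f ∈ orliczSpace hφ μ,
      Integrable f μ ∧ ∫ x, |f x| ∂μ ≤ C * orliczNorm φ μ f := by
  obtain ⟨c, hc, hle⟩ := hφ.exists_abs_le_add
  have hC : 0 < c * μ.real Set.univ + 1 := by positivity
  refine ⟨c * μ.real Set.univ + 1, fun f hf => ?_⟩
  have key : ∀ k : ℝ, 0 < k → orliczModular φ μ (k⁻¹ • f) ≤ 1 →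
      ∫⁻ x, ENNReal.ofReal |f x| ∂μ ≤ ENNReal.ofReal (k * (c * μ.real Set.univ + 1)) := by
    intro k hk hI
    calc ∫⁻ x, ENNReal.ofReal |f x| ∂μ
        ≤ ∫⁻ x, ENNReal.ofReal k *
            (ENNReal.ofReal c + ENNReal.ofReal (φ ((k⁻¹ • f) x))) ∂μ := by
          refine lintegral_mono fun x => ?_
          rw [← ENNReal.ofReal_add hc (hφ.nonneg _), ← ENNReal.ofReal_mul hk.le]
          apply ENNReal.ofReal_le_ofReal
          have := hle ((k⁻¹ • f) x)
          rw [Pi.smul_apply, smul_eq_mul, abs_mul, abs_inv, abs_of_pos hk,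
            inv_mul_le_iff₀ hk] at this
          exact this
      _ = ENNReal.ofReal k * (ENNReal.ofReal c * μ Set.univ + orliczModular φ μ (k⁻¹ • f)) := by
          rw [lintegral_const_mul' _ _ ENNReal.ofReal_ne_top,
            lintegral_add_left measurable_const, lintegral_const]
          rfl
      _ ≤ ENNReal.ofReal k * (ENNReal.ofReal c * μ Set.univ + 1) := by gcongr
      _ = ENNReal.ofReal (k * (c * μ.real Set.univ + 1)) := by
          rw [ENNReal.ofReal_mul hk.le, ENNReal.ofReal_add (by positivity) zero_le_one,
            ENNReal.ofReal_mul hc, ofReal_measureReal, ENNReal.ofReal_one]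
  obtain ⟨k₀, hk₀, hI₀⟩ := exists_orliczModular_le_one hf
  have hint : Integrable f μ := by
    refine ⟨hf.1.aestronglyMeasurable, ?_⟩
    rw [hasFiniteIntegral_iff_norm]
    exact (key k₀ hk₀ hI₀).trans_lt ENNReal.ofReal_lt_top
  refine ⟨hint, ?_⟩
  rw [← div_le_iff₀' hC]
  refine le_csInf ⟨k₀, hk₀, by rwa [lintegral_div_eq_orliczModular hφ f hk₀]⟩ ?_
  rintro k ⟨hk, hI⟩
  rw [lintegral_div_eq_orliczModular hφ f hk] at hI
  rw [div_le_iff₀ hC, ← ENNReal.ofReal_le_ofReal_iff (by positivity),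
    ofReal_integral_eq_lintegral_ofReal hint.abs (Eventually.of_forall fun x => abs_nonneg _)]
  exact key k hk hI

theorem integrable_of_mem_orliczSpace {hφ : IsYoungFunction φ} {f : Ω → ℝ}
    (hf : f ∈ orliczSpace hφ μ) : Integrable f μ :=
  ((exists_integral_abs_le_mul_orliczNorm hφ μ).choose_spec f hf).1

theorem mem_orliczSpace_of_bounded (hφ : IsYoungFunction φ) {f : Ω → ℝ} (hf : Measurable f)
    {M : ℝ} (hM : ∀ᵐ x ∂μ, |f x| ≤ M) : f ∈ orliczSpace hφ μ := by
  refine ⟨hf, 1, one_pos, ?_⟩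
  calc ∫⁻ x, ENNReal.ofReal (φ (1 * f x)) ∂μ ≤ ∫⁻ _, ENNReal.ofReal (φ M) ∂μ := by
        refine lintegral_mono_ae (hM.mono fun x hx => ?_)
        rw [one_mul]
        exact ENNReal.ofReal_le_ofReal (hφ.map_le_map_of_abs_le (hx.trans (le_abs_self M)))
    _ < ⊤ := by
        rw [lintegral_const]
        exact ENNReal.mul_lt_top ENNReal.ofReal_lt_top (measure_lt_top _ _)

/-- For uniformly bounded functions, convergence to `0` in `L¹` forces convergence of the
modulars: by convexity, `φ(c u) ≤ φ(c M) |u| / M` when `|u| ≤ M`. -/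
theorem tendsto_orliczModular_of_bounded (hφ : IsYoungFunction φ) {ι : Type*} {l : Filter ι}
    {u : ι → Ω → ℝ} (hu : ∀ i, Measurable (u i)) {M : ℝ} (hM0 : 0 < M)
    (hM : ∀ i, ∀ᵐ x ∂μ, |u i x| ≤ M)
    (h : Tendsto (fun i => ∫ x, |u i x| ∂μ) l (𝓝 0)) (c : ℝ) :
    Tendsto (fun i => orliczModular φ μ (c • u i)) l (𝓝 0) := by
  have hlim : Tendsto (fun i => ENNReal.ofReal (φ (c * M) / M * ∫ x, |u i x| ∂μ)) l (𝓝 0) := by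
    simpa using ENNReal.tendsto_ofReal (h.const_mul (φ (c * M) / M))
  refine tendsto_of_tendsto_of_tendsto_of_le_of_le tendsto_const_nhds hlim
    (fun _ => zero_le) fun i => ?_
  have hint : Integrable (fun x => |u i x|) μ :=
    (Integrable.of_bound (hu i).aestronglyMeasurable M (hM i)).abs
  have h0 : 0 ≤ φ (c * M) / M := div_nonneg (hφ.nonneg _) hM0.le
  calc orliczModular φ μ (c • u i)
      ≤ ∫⁻ x, ENNReal.ofReal (φ (c * M) / M * |u i x|) ∂μ := by
        refine lintegral_mono_ae ((hM i).mono fun x hx => ENNReal.ofReal_le_ofReal ?_)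
        have h1 := hφ.map_mul_le_mul (t := |u i x| / M) (by positivity)
          ((div_le_one hM0).2 hx) (c * M)
        have h2 : φ ((c • u i) x) = φ (|u i x| / M * (c * M)) := by
          rw [← hφ.map_abs ((c • u i) x), ← hφ.map_abs (|u i x| / M * (c * M))]
          congr 1
          simp only [Pi.smul_apply, smul_eq_mul, abs_mul, abs_div, abs_abs, abs_of_pos hM0]
          field_simp
        rw [h2]
        exact h1.trans (le_of_eq (by ring))
    _ = ENNReal.ofReal (φ (c * M) / M * ∫ x, |u i x| ∂μ) := by
        rw [← integral_const_mul, ofReal_integral_eq_lintegral_ofReal (hint.const_mul _)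
          (Eventually.of_forall fun x => by positivity)]

/-- Under `Δ₂`, all multiples of a member of the Orlicz space have finite modular. -/
theorem orliczModular_smul_lt_top {hφ : IsYoungFunction φ} (hΔ : SatisfiesDeltaTwo φ)
    {f : Ω → ℝ} (hf : f ∈ orliczSpace hφ μ) (c : ℝ) : orliczModular φ μ (c • f) < ⊤ := by
  obtain ⟨_, α, hα, hI⟩ := hf
  obtain ⟨K, C, hK, hC, hle⟩ := hφ.exists_map_mul_le hΔ (c / α)
  calc orliczModular φ μ (c • f)
      ≤ ∫⁻ x, (ENNReal.ofReal C + ENNReal.ofReal K * ENNReal.ofReal (φ (α * f x))) ∂μ := by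
        refine lintegral_mono fun x => ?_
        rw [← ENNReal.ofReal_mul hK, ← ENNReal.ofReal_add hC (mul_nonneg hK (hφ.nonneg _))]
        apply ENNReal.ofReal_le_ofReal
        have := hle (α * f x)
        rw [← mul_assoc, div_mul_cancel₀ _ hα.ne'] at this
        rw [Pi.smul_apply, smul_eq_mul]
        linarith
    _ = ENNReal.ofReal C * μ Set.univ +
          ENNReal.ofReal K * ∫⁻ x, ENNReal.ofReal (φ (α * f x)) ∂μ := by
        rw [lintegral_add_left measurable_const, lintegral_const,
          lintegral_const_mul' _ _ ENNReal.ofReal_ne_top]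
    _ < ⊤ := ENNReal.add_lt_top.2 ⟨ENNReal.mul_lt_top ENNReal.ofReal_lt_top (measure_lt_top _ _),
        ENNReal.mul_lt_top ENNReal.ofReal_lt_top hI⟩

end Modular

section CondExp

-- The ambient `σ`-algebra `mΩ` comes last, so that it is the one found by instance resolution.
variable {Ω : Type*} {m : MeasurableSpace Ω} [mΩ : MeasurableSpace Ω] {φ : ℝ → ℝ} {μ : Measure Ω}
  [IsFiniteMeasure μ]

/-- The conditional Jensen inequality, integrated: conditional expectations do not increase the
modular. -/
theorem orliczModular_condExp_le (hφ : IsYoungFunction φ) (hm : m ≤ mΩ)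
    {f : Ω → ℝ} (hf : Integrable f μ) (c : ℝ) :
    orliczModular φ μ (c • μ[f|m]) ≤ orliczModular φ μ (c • f) := by
  rcases eq_or_ne (orliczModular φ μ (c • f)) ⊤ with htop | htop
  · rw [htop]; exact le_top
  have hint : Integrable (φ ∘ (c • f)) μ := by
    refine ⟨hφ.continuous.comp_aestronglyMeasurable (hf.smul c).aestronglyMeasurable, ?_⟩
    rw [hasFiniteIntegral_iff_ofReal (f := φ ∘ (c • f)) (Eventually.of_forall fun x => hφ.nonneg _)]
    exact lt_top_iff_ne_top.2 htop
  have hJ := hφ.convexOn.map_condExp_le_univ hm hφ.continuous.lowerSemicontinuous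
    (hf.smul c) hint
  calc orliczModular φ μ (c • μ[f|m])
      = orliczModular φ μ (μ[c • f|m]) := orliczModular_congr_ae (condExp_smul c f m).symm
    _ ≤ ∫⁻ x, ENNReal.ofReal ((μ[φ ∘ (c • f)|m]) x) ∂μ :=
        lintegral_mono_ae (hJ.mono fun x hx => ENNReal.ofReal_le_ofReal hx)
    _ = ENNReal.ofReal (∫ x, (μ[φ ∘ (c • f)|m]) x ∂μ) :=
        (ofReal_integral_eq_lintegral_ofReal integrable_condExp
          (condExp_nonneg (Eventually.of_forall fun x => hφ.nonneg _))).symm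
    _ = ENNReal.ofReal (∫ x, (φ ∘ (c • f)) x ∂μ) := by rw [integral_condExp hm]
    _ = orliczModular φ μ (c • f) :=
        ofReal_integral_eq_lintegral_ofReal hint (Eventually.of_forall fun x => hφ.nonneg _)

theorem condExp_mem_orliczSpace {hφ : IsYoungFunction φ} (hm : m ≤ mΩ)
    {f : Ω → ℝ} (hf : f ∈ orliczSpace hφ μ) : μ[f|m] ∈ orliczSpace hφ μ := by
  have hint := integrable_of_mem_orliczSpace hf
  obtain ⟨_, α, hα, hI⟩ := hf
  exact ⟨(stronglyMeasurable_condExp.mono hm).measurable, α, hα,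
    (orliczModular_condExp_le hφ hm hint α).trans_lt hI⟩

end CondExp

/-! ### Truncation -/

section Truncation

variable {Ω : Type*} [mΩ : MeasurableSpace Ω] {φ : ℝ → ℝ} {μ : Measure Ω}

theorem exists_bounded_approx {f : Ω → ℝ} (hf : Measurable f) : ∃ g : ℕ → Ω → ℝ,
    (∀ N, Measurable (g N)) ∧ (∀ N x, |g N x| ≤ N) ∧ (∀ N x, |f x - g N x| ≤ |f x|) ∧
      ∀ x, ∀ᶠ N in atTop, g N x = f x := by
  refine ⟨fun N => {x | |f x| ≤ N}.indicator f, fun N => ?_, fun N x => ?_, fun N x => ?_,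
    fun x => ?_⟩
  · exact hf.indicator (measurableSet_le (by fun_prop) measurable_const)
  · by_cases h : |f x| ≤ N <;> simp [Set.indicator, h]
  · by_cases h : |f x| ≤ N <;> simp [Set.indicator, h]
  · filter_upwards [eventually_ge_atTop ⌈|f x|⌉₊] with N hN
    have : |f x| ≤ N := Nat.ceil_le.1 hN
    simp [Set.indicator, this]

theorem exists_bounded_integral_abs_sub_lt {f : Ω → ℝ} (hf : Measurable f) (hint : Integrable f μ)
    {ε : ℝ} (hε : 0 < ε) : ∃ (g : Ω → ℝ) (M : ℝ), Measurable g ∧ (∀ x, |g x| ≤ M) ∧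
      ∫ x, |f x - g x| ∂μ < ε := by
  obtain ⟨g, hg, hgN, hfg, hlim⟩ := exists_bounded_approx hf
  have : Tendsto (fun N => ∫ x, |f x - g N x| ∂μ) atTop (𝓝 (∫ _, (0 : ℝ) ∂μ)) := by
    refine tendsto_integral_of_dominated_convergence (fun x => |f x|)
      (fun N => (hf.sub (hg N)).abs.aestronglyMeasurable) hint.abs
      (fun N => Eventually.of_forall fun x => ?_) (Eventually.of_forall fun x => ?_)
    · simp only [Real.norm_eq_abs, abs_abs]
      exact hfg N x
    · refine tendsto_const_nhds.congr' ((hlim x).mono fun N hN => ?_)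
      simp [hN]
  rw [integral_zero] at this
  obtain ⟨N, hN⟩ := (this.eventually_lt_const hε).exists
  exact ⟨g N, N, hg N, hgN N, hN⟩

/-- Under `Δ₂`, bounded functions are dense in the Orlicz space, also with respect to the
modular of any multiple. -/
theorem exists_bounded_orliczModular_sub_lt [IsFiniteMeasure μ] {hφ : IsYoungFunction φ}
    (hΔ : SatisfiesDeltaTwo φ) {f : Ω → ℝ} (hf : f ∈ orliczSpace hφ μ) (c : ℝ) {ε : ENNReal}
    (hε : 0 < ε) : ∃ (g : Ω → ℝ) (M : ℝ), Measurable g ∧ (∀ x, |g x| ≤ M) ∧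
      orliczModular φ μ (c • (f - g)) < ε := by
  obtain ⟨g, hg, hgN, hfg, hlim⟩ := exists_bounded_approx hf.1
  have : Tendsto (fun N => orliczModular φ μ (c • (f - g N))) atTop (𝓝 (∫⁻ _, 0 ∂μ)) := by
    refine tendsto_lintegral_of_dominated_convergence
      (fun x => ENNReal.ofReal (φ ((c • f) x)))
      (fun N => hφ.measurable_ofReal_comp ((hf.1.sub (hg N)).const_smul c))
      (fun N => Eventually.of_forall fun x => ?_) (orliczModular_smul_lt_top hΔ hf c).ne
      (Eventually.of_forall fun x => ?_)
    · apply ENNReal.ofReal_le_ofReal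
      apply hφ.map_le_map_of_abs_le
      simp only [Pi.smul_apply, Pi.sub_apply, smul_eq_mul, abs_mul]
      exact mul_le_mul_of_nonneg_left (hfg N x) (abs_nonneg c)
    · refine tendsto_const_nhds.congr' ((hlim x).mono fun N hN => ?_)
      simp [hN, hφ.map_zero]
  rw [lintegral_zero] at this
  obtain ⟨N, hN⟩ := (this.eventually_lt_const hε).exists
  exact ⟨g N, N, hg N, hgN N, hN⟩

end Truncation

/-! ### Conditional expectations in `L¹` -/

/-- The `L¹`-distance between the conditional expectations of `f` given `m₁` and given `m₂`. -/
noncomputable def condExpL1Dist {Ω : Type*} (m₁ m₂ : MeasurableSpace Ω) [MeasurableSpace Ω]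
    (μ : Measure Ω) (f : Ω → ℝ) : ℝ :=
  ∫ x, |(μ[f|m₁]) x - (μ[f|m₂]) x| ∂μ

theorem integrable_abs_condExp_sub_condExp {Ω : Type*} (m₁ m₂ : MeasurableSpace Ω)
    [MeasurableSpace Ω] (μ : Measure Ω) (f g : Ω → ℝ) :
    Integrable (fun x => |(μ[f|m₁]) x - (μ[g|m₂]) x|) μ :=
  (integrable_condExp.sub integrable_condExp).abs

theorem abs_indicator_one_le {Ω : Type*} (A : Set Ω) (x : Ω) :
    |A.indicator (fun _ => (1 : ℝ)) x| ≤ 1 := by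
  by_cases h : x ∈ A <;> simp [h]

section CondExpL1

variable {Ω : Type*} {𝒜 : ℕ → MeasurableSpace Ω} {m₁ m₂ 𝔇 : MeasurableSpace Ω}
  [mΩ : MeasurableSpace Ω] {μ : Measure Ω}

theorem condExpL1Dist_nonneg (f : Ω → ℝ) : 0 ≤ condExpL1Dist m₁ m₂ μ f :=
  integral_nonneg fun _ => abs_nonneg _

theorem condExpL1Dist_le {f g : Ω → ℝ} (hf : Integrable f μ) (hg : Integrable g μ) :
    condExpL1Dist m₁ m₂ μ f ≤ 2 * ∫ x, |f x - g x| ∂μ + condExpL1Dist m₁ m₂ μ g := by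
  have h₁ := integral_abs_condExp_le (m := m₁) (μ := μ) (f - g)
  have h₂ := integral_abs_condExp_le (m := m₂) (μ := μ) (f - g)
  have i₁ : Integrable (fun x => |(μ[f - g|m₁]) x|) μ := integrable_condExp.abs
  have i₂ : Integrable (fun x => |(μ[f - g|m₂]) x|) μ := integrable_condExp.abs
  have i₃ := integrable_abs_condExp_sub_condExp m₁ m₂ μ g g
  have i₁₂ : Integrable (fun x => |(μ[f - g|m₁]) x| + |(μ[f - g|m₂]) x|) μ := i₁.add i₂
  have key : condExpL1Dist m₁ m₂ μ f ≤ ∫ x, (|(μ[f - g|m₁]) x| + |(μ[f - g|m₂]) x| +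
      |(μ[g|m₁]) x - (μ[g|m₂]) x|) ∂μ := by
    refine integral_mono_ae (integrable_condExp.sub integrable_condExp).abs (i₁₂.add i₃) ?_
    filter_upwards [condExp_sub hf hg m₁, condExp_sub hf hg m₂] with x hx₁ hx₂
    rw [hx₁, hx₂, Pi.sub_apply, Pi.sub_apply]
    calc |(μ[f|m₁]) x - (μ[f|m₂]) x|
        = |((μ[f|m₁]) x - (μ[g|m₁]) x) + -((μ[f|m₂]) x - (μ[g|m₂]) x) +
            ((μ[g|m₁]) x - (μ[g|m₂]) x)| := by congr 1; ring
      _ ≤ _ := by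
        refine (abs_add_three _ _ _).trans ?_
        rw [abs_neg]
  rw [integral_add i₁₂ i₃, integral_add i₁ i₂] at key
  simp only [Pi.sub_apply] at h₁ h₂
  unfold condExpL1Dist at key ⊢
  linarith

theorem tendsto_condExpL1Dist_of_approx {f : Ω → ℝ} (hf : Integrable f μ)
    (h : ∀ ε : ℝ, 0 < ε → ∃ g : Ω → ℝ, Integrable g μ ∧ ∫ x, |f x - g x| ∂μ < ε ∧
      Tendsto (fun n => condExpL1Dist (𝒜 n) 𝔇 μ g) atTop (𝓝 0)) :
    Tendsto (fun n => condExpL1Dist (𝒜 n) 𝔇 μ f) atTop (𝓝 0) := by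
  rw [Metric.tendsto_nhds]
  intro ε hε
  obtain ⟨g, hg, hfg, hlim⟩ := h (ε / 4) (by positivity)
  filter_upwards [hlim.eventually_lt_const (half_pos hε)] with n hn
  rw [Real.dist_eq, sub_zero, abs_of_nonneg (condExpL1Dist_nonneg f)]
  linarith [condExpL1Dist_le (m₁ := 𝒜 n) (m₂ := 𝔇) hf hg]

/-- `L¹`-convergence of the conditional expectations of bounded functions extends to all
integrable functions. -/
theorem tendsto_condExpL1Dist_of_forall_bounded [IsFiniteMeasure μ]
    (h : ∀ (g : Ω → ℝ) (M : ℝ), Measurable g → (∀ x, |g x| ≤ M) →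
      Tendsto (fun n => condExpL1Dist (𝒜 n) 𝔇 μ g) atTop (𝓝 0))
    {f : Ω → ℝ} (hf : Measurable f) (hint : Integrable f μ) :
    Tendsto (fun n => condExpL1Dist (𝒜 n) 𝔇 μ f) atTop (𝓝 0) := by
  refine tendsto_condExpL1Dist_of_approx hint fun ε hε => ?_
  obtain ⟨g, M, hg, hM, hfg⟩ := exists_bounded_integral_abs_sub_lt hf hint hε
  exact ⟨g, .of_bound hg.aestronglyMeasurable M (Eventually.of_forall hM), hfg, h g M hg hM⟩

theorem measurable_condExpPerp (h𝔇 : 𝔇 ≤ mΩ) {f : Ω → ℝ} (hf : Measurable f) :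
    Measurable (condExpPerp 𝔇 μ f) :=
  hf.sub (stronglyMeasurable_condExp.mono h𝔇).measurable

theorem ae_abs_condExpPerp_le {f : Ω → ℝ} {M : ℝ} (hM : ∀ x, |f x| ≤ M) :
    ∀ᵐ x ∂μ, |condExpPerp 𝔇 μ f x| ≤ 2 * M := by
  filter_upwards [ae_bdd_abs_condExp_of_ae_bdd_abs (m := 𝔇) (μ := μ) (Eventually.of_forall hM)]
    with x hx
  rw [condExpPerp, Pi.sub_apply]
  linarith [abs_sub (f x) ((μ[f|𝔇]) x), hM x]

theorem integral_abs_condExpPerp_le {f : Ω → ℝ} (hf : Integrable f μ) :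
    ∫ x, |condExpPerp 𝔇 μ f x| ∂μ ≤ 2 * ∫ x, |f x| ∂μ := by
  have h := integral_abs_condExp_le (m := 𝔇) (μ := μ) f
  have hE : Integrable (fun x => |(μ[f|𝔇]) x|) μ := integrable_condExp.abs
  have : ∫ x, |condExpPerp 𝔇 μ f x| ∂μ ≤ ∫ x, (|f x| + |(μ[f|𝔇]) x|) ∂μ :=
    integral_mono (hf.sub integrable_condExp).abs (hf.abs.add hE) fun x => abs_sub _ _
  rw [integral_add hf.abs hE] at this
  linarith

theorem condExp_condExpPerp (h𝔇 : 𝔇 ≤ mΩ) [IsFiniteMeasure μ] {f : Ω → ℝ}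
    (hf : Integrable f μ) : μ[condExpPerp 𝔇 μ f|𝔇] =ᵐ[μ] 0 := by
  filter_upwards [condExp_sub hf (integrable_condExp (m := 𝔇) (f := f)) 𝔇] with x hx
  rw [condExpPerp, hx, condExp_of_stronglyMeasurable h𝔇 stronglyMeasurable_condExp
    integrable_condExp]
  simp

theorem condExpPerp_mem_orliczSpace {φ : ℝ → ℝ} (hφ : IsYoungFunction φ) [IsFiniteMeasure μ]
    (h𝔇 : 𝔇 ≤ mΩ) {f : Ω → ℝ} (hf : Measurable f) {M : ℝ} (hM : ∀ x, |f x| ≤ M) :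
    condExpPerp 𝔇 μ f ∈ orliczSpace hφ μ :=
  mem_orliczSpace_of_bounded hφ (measurable_condExpPerp h𝔇 hf) (ae_abs_condExpPerp_le hM)

theorem integrable_indicator_one [IsFiniteMeasure μ] {A : Set Ω} (hA : MeasurableSet A) :
    Integrable (A.indicator fun _ => (1 : ℝ)) μ :=
  (integrable_const _).indicator hA

theorem condExpPerp_indicator_mem_orliczSpace {φ : ℝ → ℝ} (hφ : IsYoungFunction φ)
    [IsFiniteMeasure μ] (h𝔇 : 𝔇 ≤ mΩ) {A : Set Ω} (hA : MeasurableSet A) :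
    condExpPerp 𝔇 μ (A.indicator fun _ => (1 : ℝ)) ∈ orliczSpace hφ μ :=
  condExpPerp_mem_orliczSpace hφ h𝔇 (measurable_const.indicator hA) (abs_indicator_one_le A)

/-! ### From `μ⊥`-convergence to `L¹`-convergence -/

theorem MuConverges.tendsto_condExpL1Dist_indicator [IsFiniteMeasure μ] (h : MuConverges 𝒜 𝔇 μ)
    (h𝒜 : ∀ n, 𝒜 n ≤ mΩ) (h𝔇 : 𝔇 ≤ mΩ) (c : ℝ) {D : Set Ω} (hD : MeasurableSet[𝔇] D) :
    Tendsto (fun n => condExpL1Dist (𝒜 n) 𝔇 μ (D.indicator fun _ => c)) atTop (𝓝 0) := by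
  obtain ⟨A, hA, hlim⟩ := h D hD
  have hint : ∀ B : Set Ω, MeasurableSet B → Integrable (B.indicator fun _ => c) μ :=
    fun B hB => (integrable_const c).indicator hB
  have hlim' : Tendsto (fun n => 2 * (|c| * μ.real (symmDiff (A n) D))) atTop (𝓝 0) := by
    have : Tendsto (fun n => μ.real (symmDiff (A n) D)) atTop (𝓝 0) := by
      exact (ENNReal.tendsto_toReal ENNReal.zero_ne_top).comp hlim
    simpa using (this.const_mul |c|).const_mul 2
  refine squeeze_zero (fun n => condExpL1Dist_nonneg _) (fun n => ?_) hlim'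
  set f : Ω → ℝ := D.indicator fun _ => c
  set g : Ω → ℝ := (A n).indicator fun _ => c
  have hf : Integrable f μ := hint D (h𝔇 _ hD)
  have hg : Integrable g μ := hint (A n) (h𝒜 n _ (hA n))
  have hfg : ∫ x, |f x - g x| ∂μ = |c| * μ.real (symmDiff (A n) D) := by
    have : (fun x => |f x - g x|) = (symmDiff (A n) D).indicator fun _ => |c| := by
      ext x
      by_cases h₁ : x ∈ A n <;> by_cases h₂ : x ∈ D <;>
        simp [f, g, h₁, h₂, Set.indicator, Set.mem_symmDiff]
    rw [this, integral_indicator_const _ ((h𝒜 n _ (hA n)).symmDiff (h𝔇 _ hD)), smul_eq_mul,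
      mul_comm]
  -- Both `E(f | 𝔇) = f` and `E(g | 𝒜 n) = g`.
  have key : condExpL1Dist (𝒜 n) 𝔇 μ f ≤
      ∫ x, (|(μ[f - g|𝒜 n]) x| + |f x - g x|) ∂μ := by
    refine integral_mono_ae (integrable_condExp.sub integrable_condExp).abs
      (integrable_condExp.abs.add (hf.sub hg).abs) ?_
    filter_upwards [condExp_sub hf hg (𝒜 n)] with x hx
    rw [condExp_of_stronglyMeasurable h𝔇 (stronglyMeasurable_const.indicator hD) hf, hx,
      condExp_of_stronglyMeasurable (h𝒜 n) (stronglyMeasurable_const.indicator (hA n)) hg,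
      Pi.sub_apply]
    calc |(μ[f|𝒜 n]) x - f x| = |((μ[f|𝒜 n]) x - g x) - (f x - g x)| := by congr 1; ring
      _ ≤ _ := abs_sub _ _
  have hle := integral_abs_condExp_le (m := 𝒜 n) (μ := μ) (f - g)
  simp only [Pi.sub_apply] at hle
  have hfg' : Integrable (fun x => |f x - g x|) μ := (hf.sub hg).abs
  rw [integral_add integrable_condExp.abs hfg'] at key
  linarith

theorem MuConverges.tendsto_condExpL1Dist [IsFiniteMeasure μ] (h : MuConverges 𝒜 𝔇 μ)
    (h𝒜 : ∀ n, 𝒜 n ≤ mΩ) (h𝔇 : 𝔇 ≤ mΩ) {f : Ω → ℝ} (hf : StronglyMeasurable[𝔇] f)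
    (hint : Integrable f μ) :
    Tendsto (fun n => condExpL1Dist (𝒜 n) 𝔇 μ f) atTop (𝓝 0) := by
  refine tendsto_condExpL1Dist_of_approx hint fun ε hε => ?_
  -- Approximate `f` by `𝔇`-simple functions: work in `L¹` of the restriction of `μ` to `𝔇`.
  have hmem : MemLp f 1 (μ.trim h𝔇) := memLp_one_iff_integrable.2 (hint.trim h𝔇 hf)
  obtain ⟨g, hfg, hg, hgint, hlim⟩ := @MemLp.induction_dense Ω ℝ 𝔇 _ 1 (μ.trim h𝔇)
    ENNReal.one_ne_top
    (fun g : Ω → ℝ => StronglyMeasurable[𝔇] g ∧ Integrable g μ ∧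
      Tendsto (fun n => condExpL1Dist (𝒜 n) 𝔇 μ g) atTop (𝓝 0))
    (fun c D hD _ δ _ => ⟨D.indicator fun _ => c, by simp,
      stronglyMeasurable_const.indicator hD, (integrable_const c).indicator (h𝔇 _ hD),
      h.tendsto_condExpL1Dist_indicator h𝒜 h𝔇 c hD⟩)
    (fun g₁ g₂ h₁ h₂ => ⟨h₁.1.add h₂.1, h₁.2.1.add h₂.2.1, by
      refine squeeze_zero (fun n => condExpL1Dist_nonneg _) (fun n => ?_)
        (by simpa using h₁.2.2.add h₂.2.2)
      have i₁ := integrable_abs_condExp_sub_condExp (𝒜 n) 𝔇 μ g₁ g₁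
      have i₂ := integrable_abs_condExp_sub_condExp (𝒜 n) 𝔇 μ g₂ g₂
      rw [condExpL1Dist, condExpL1Dist, condExpL1Dist, ← integral_add i₁ i₂]
      refine integral_mono_ae (integrable_abs_condExp_sub_condExp _ _ _ _ _) (i₁.add i₂) ?_
      filter_upwards [condExp_add h₁.2.1 h₂.2.1 (𝒜 n), condExp_add h₁.2.1 h₂.2.1 𝔇] with x hx hx'
      rw [hx, hx', Pi.add_apply, Pi.add_apply, add_sub_add_comm]
      exact abs_add_le _ _⟩)
    (fun g hg => hg.1.aestronglyMeasurable) f hmem (ENNReal.ofReal (ε / 2)) (by simpa using hε)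
  refine ⟨g, hgint, ?_, hlim⟩
  rw [eLpNorm_trim h𝔇 (hf.sub hg), eLpNorm_one_eq_lintegral_enorm] at hfg
  have : ∫ x, |(f - g) x| ∂μ ≤ ε / 2 := by
    rw [← ENNReal.ofReal_le_ofReal_iff (by positivity),
      ofReal_integral_eq_lintegral_ofReal (hint.sub hgint).abs
        (Eventually.of_forall fun x => abs_nonneg _)]
    simpa only [Real.enorm_eq_ofReal_abs] using hfg
  simp only [Pi.sub_apply] at this
  linarith

/-- Orthogonal convergence, tested on the functionals `u ↦ ∫ u w dμ` with `w` bounded and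
orthogonal to `𝔇`. -/
theorem PerpConverges.tendsto_setIntegral {φ : ℝ → ℝ} {hφ : IsYoungFunction φ}
    [IsFiniteMeasure μ] (h : PerpConverges 𝒜 𝔇 hφ μ) (h𝒜 : ∀ n, 𝒜 n ≤ mΩ) (h𝔇 : 𝔇 ≤ mΩ)
    {w : Ω → ℝ} (hw : Measurable w) {M : ℝ} (hM : ∀ᵐ x ∂μ, |w x| ≤ M)
    (hw0 : μ[w|𝔇] =ᵐ[μ] 0) {A : ℕ → Set Ω} (hA : ∀ n, MeasurableSet[𝒜 n] (A n)) :
    Tendsto (fun n => ∫ x in A n, w x ∂μ) atTop (𝓝 0) := by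
  obtain ⟨C, hC⟩ := exists_integral_abs_le_mul_orliczNorm hφ μ
  have hmul : ∀ f : Ω → ℝ, Integrable f μ → Integrable (fun x => f x * w x) μ := fun f hf =>
    hf.mul_bdd hw.aestronglyMeasurable hM
  let ℓ : orliczSpace hφ μ →ₗ[ℝ] ℝ :=
    { toFun := fun f => ∫ x, f.1 x * w x ∂μ
      map_add' := fun f g => by
        rw [← integral_add (hmul _ (hC _ f.2).1) (hmul _ (hC _ g.2).1)]
        simp [add_mul]
      map_smul' := fun c f => by
        simp [mul_assoc, integral_const_mul] }
  have hℓ : ∀ f : orliczSpace hφ μ, |ℓ f| ≤ (max M 0 * C) * orliczNorm φ μ f := by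
    intro f
    calc |ℓ f| ≤ ∫ x, |f.1 x * w x| ∂μ := abs_integral_le_integral_abs
      _ ≤ ∫ x, max M 0 * |f.1 x| ∂μ := by
        refine integral_mono_ae (hmul _ (hC _ f.2).1).abs ((hC _ f.2).1.abs.const_mul _) ?_
        filter_upwards [hM] with x hx
        rw [abs_mul, mul_comm]
        gcongr
        exact hx.trans (le_max_left _ _)
      _ = max M 0 * ∫ x, |f.1 x| ∂μ := integral_const_mul _ _
      _ ≤ max M 0 * (C * orliczNorm φ μ f) := by
        gcongr
        exact (hC _ f.2).2
      _ = _ := by ring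
  obtain ⟨hu, hv, hweak⟩ := h A hA
  have hlim := hweak ℓ ⟨_, hℓ⟩
  have hzero : ℓ ⟨0, hv⟩ = 0 := by simp [ℓ]
  rw [hzero] at hlim
  refine hlim.congr fun n => ?_
  have hAn := h𝒜 n _ (hA n)
  set χ : Ω → ℝ := (A n).indicator fun _ => (1 : ℝ)
  have hχ : Integrable χ μ := integrable_indicator_one hAn
  have hmulE : Integrable (fun x => (μ[χ|𝔇]) x * w x) μ := hmul _ integrable_condExp
  -- `E(χ | 𝔇)` contributes nothing, since `w` is orthogonal to `𝔇`.
  have h0 : ∫ x, (μ[χ|𝔇]) x * w x ∂μ = 0 := by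
    have hwint : Integrable w μ := .of_bound hw.aestronglyMeasurable M hM
    calc ∫ x, (μ[χ|𝔇]) x * w x ∂μ = ∫ x, (μ[μ[χ|𝔇] * w|𝔇]) x ∂μ := (integral_condExp h𝔇).symm
      _ = ∫ _, (0 : ℝ) ∂μ := by
        refine integral_congr_ae ?_
        filter_upwards [condExp_mul_of_stronglyMeasurable_left stronglyMeasurable_condExp hmulE
          hwint, hw0] with x hx hx0
        rw [hx, Pi.mul_apply, hx0, Pi.zero_apply, mul_zero]
      _ = 0 := integral_zero _ _
  calc ∫ x, condExpPerp 𝔇 μ χ x * w x ∂μ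
      = ∫ x, (χ x * w x - (μ[χ|𝔇]) x * w x) ∂μ := by simp [condExpPerp, sub_mul]
    _ = ∫ x, χ x * w x ∂μ := by rw [integral_sub (hmul _ hχ) hmulE, h0, sub_zero]
    _ = ∫ x in A n, w x ∂μ := by
      rw [← integral_indicator hAn]
      refine integral_congr_ae (Eventually.of_forall fun x => ?_)
      by_cases hx : x ∈ A n <;> simp [χ, hx]

theorem PerpConverges.tendsto_integral_abs_condExp {φ : ℝ → ℝ} {hφ : IsYoungFunction φ}
    [IsFiniteMeasure μ] (h : PerpConverges 𝒜 𝔇 hφ μ) (h𝒜 : ∀ n, 𝒜 n ≤ mΩ) (h𝔇 : 𝔇 ≤ mΩ)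
    {w : Ω → ℝ} (hw : Measurable w) {M : ℝ} (hM : ∀ᵐ x ∂μ, |w x| ≤ M)
    (hw0 : μ[w|𝔇] =ᵐ[μ] 0) :
    Tendsto (fun n => ∫ x, |(μ[w|𝒜 n]) x| ∂μ) atTop (𝓝 0) := by
  have hwint : Integrable w μ := .of_bound hw.aestronglyMeasurable M hM
  -- The sets on which `|E(w | 𝒜 n)|` is `E(w | 𝒜 n)`; on their complements it is `-E(w | 𝒜 n)`.
  let A : ℕ → Set Ω := fun n => {x | 0 ≤ (μ[w|𝒜 n]) x}
  have hA : ∀ n, MeasurableSet[𝒜 n] (A n) := fun n =>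
    stronglyMeasurable_condExp.measurable measurableSet_Ici
  have h₁ := h.tendsto_setIntegral h𝒜 h𝔇 hw hM hw0 hA
  have h₂ := h.tendsto_setIntegral h𝒜 h𝔇 hw hM hw0 (fun n => (hA n).compl)
  have h₁₂ := h₁.sub h₂
  rw [sub_zero] at h₁₂
  refine h₁₂.congr fun n => ?_
  have hAn := h𝒜 n _ (hA n)
  rw [← setIntegral_condExp (h𝒜 n) hwint (hA n), ← setIntegral_condExp (h𝒜 n) hwint (hA n).compl,
    ← integral_add_compl hAn (integrable_condExp.abs (f := μ[w|𝒜 n])), sub_eq_add_neg,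
    ← integral_neg]
  congr 1
  · exact setIntegral_congr_fun hAn fun x hx => (abs_of_nonneg hx).symm
  · exact setIntegral_congr_fun hAn.compl fun x (hx : ¬0 ≤ (μ[w|𝒜 n]) x) =>
      (abs_of_neg (not_le.1 hx)).symm

/-- `μ⊥`-convergence yields convergence of all conditional expectations in `L¹`. -/
theorem MuPerpConverges.tendsto_condExpL1Dist {φ : ℝ → ℝ} {hφ : IsYoungFunction φ}
    [IsFiniteMeasure μ] (h : MuPerpConverges 𝒜 𝔇 hφ μ) (h𝒜 : ∀ n, 𝒜 n ≤ mΩ) (h𝔇 : 𝔇 ≤ mΩ)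
    {f : Ω → ℝ} (hf : Measurable f) (hint : Integrable f μ) :
    Tendsto (fun n => condExpL1Dist (𝒜 n) 𝔇 μ f) atTop (𝓝 0) := by
  refine tendsto_condExpL1Dist_of_forall_bounded (fun g M hg hM => ?_) hf hint
  have hgint : Integrable g μ := .of_bound hg.aestronglyMeasurable M (Eventually.of_forall hM)
  have h₁ := h.2.tendsto_integral_abs_condExp h𝒜 h𝔇 (measurable_condExpPerp h𝔇 hg)
    (ae_abs_condExpPerp_le hM) (condExp_condExpPerp h𝔇 hgint)
  have h₂ := h.1.tendsto_condExpL1Dist h𝒜 h𝔇 stronglyMeasurable_condExp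
    (integrable_condExp (m := 𝔇) (μ := μ) (f := g))
  refine squeeze_zero (fun n => condExpL1Dist_nonneg _) (fun n => ?_) (by simpa using h₁.add h₂)
  have i := integrable_abs_condExp_sub_condExp (𝒜 n) 𝔇 μ (μ[g|𝔇]) (μ[g|𝔇])
  rw [condExpL1Dist, condExpL1Dist, ← integral_add integrable_condExp.abs i]
  refine integral_mono_ae (integrable_abs_condExp_sub_condExp _ _ _ _ _)
    (integrable_condExp.abs.add i) ?_
  filter_upwards [condExp_sub hgint (integrable_condExp (m := 𝔇) (μ := μ) (f := g)) (𝒜 n)]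
    with x hx
  rw [condExpPerp, hx, condExp_of_stronglyMeasurable h𝔇 stronglyMeasurable_condExp
    integrable_condExp (f := μ[g|𝔇]), Pi.sub_apply]
  refine le_trans (le_of_eq ?_) (abs_add_le _ _)
  congr 1
  ring

end CondExpL1

/-! ### From `L¹`-convergence to `μ⊥`-convergence -/

section Converse

variable {Ω : Type*} {𝒜 : ℕ → MeasurableSpace Ω} {𝔇 : MeasurableSpace Ω}
  [mΩ : MeasurableSpace Ω] {μ : Measure Ω} [IsFiniteMeasure μ]

/-- The sets `{E(χ_D | 𝒜 n) ≥ 1/2}` approximate `D`. -/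
theorem muConverges_of_tendsto_condExpL1Dist (h𝔇 : 𝔇 ≤ mΩ)
    (h : ∀ f : Ω → ℝ, Measurable f → Integrable f μ →
      Tendsto (fun n => condExpL1Dist (𝒜 n) 𝔇 μ f) atTop (𝓝 0)) :
    MuConverges 𝒜 𝔇 μ := by
  intro D hD
  set χ : Ω → ℝ := D.indicator fun _ => (1 : ℝ) with hχdef
  have hχ : Integrable χ μ := integrable_indicator_one (h𝔇 _ hD)
  have hlim := h χ (measurable_const.indicator (h𝔇 _ hD)) hχ
  refine ⟨fun n => {x | 1 / 2 ≤ (μ[χ|𝒜 n]) x},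
    fun n => stronglyMeasurable_condExp.measurable measurableSet_Ici, ?_⟩
  have hlim' : Tendsto (fun n => ENNReal.ofReal (2 * condExpL1Dist (𝒜 n) 𝔇 μ χ)) atTop (𝓝 0) := by
    simpa using ENNReal.tendsto_ofReal (hlim.const_mul 2)
  refine tendsto_of_tendsto_of_tendsto_of_le_of_le tendsto_const_nhds hlim'
    (fun _ => zero_le) fun n => ?_
  have hsub : symmDiff {x | 1 / 2 ≤ (μ[χ|𝒜 n]) x} D ⊆
      {x | 1 / 2 ≤ |(μ[χ|𝒜 n]) x - (μ[χ|𝔇]) x|} := by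
    intro x hx
    rw [Set.mem_ofPred_eq,
      condExp_of_stronglyMeasurable h𝔇 (stronglyMeasurable_const.indicator hD) hχ]
    rcases hx with ⟨h₁, h₂⟩ | ⟨h₁, h₂⟩
    · rw [hχdef, Set.indicator_of_notMem h₂, ← hχdef, sub_zero]
      exact le_trans h₁ (le_abs_self _)
    · have h₂ : (μ[χ|𝒜 n]) x < 1 / 2 := not_le.1 (show ¬1 / 2 ≤ (μ[χ|𝒜 n]) x from h₂)
      rw [hχdef, Set.indicator_of_mem h₁, ← hχdef, abs_sub_comm]
      exact le_trans (by linarith) (le_abs_self _)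
  have hmarkov := mul_meas_ge_le_integral_of_nonneg
    (Eventually.of_forall fun x => abs_nonneg ((μ[χ|𝒜 n]) x - (μ[χ|𝔇]) x))
    (integrable_abs_condExp_sub_condExp (𝒜 n) 𝔇 μ χ χ) (1 / 2)
  calc _ ≤ μ {x | 1 / 2 ≤ |(μ[χ|𝒜 n]) x - (μ[χ|𝔇]) x|} := measure_mono hsub
    _ = ENNReal.ofReal (μ.real {x | 1 / 2 ≤ |(μ[χ|𝒜 n]) x - (μ[χ|𝔇]) x|}) := by
      rw [ofReal_measureReal]
    _ ≤ _ := by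
      apply ENNReal.ofReal_le_ofReal
      rw [condExpL1Dist]
      linarith

variable {φ : ℝ → ℝ} {hφ : IsYoungFunction φ}

theorem tendsto_map_condExpPerp_indicator {ℓ : orliczSpace hφ μ →ₗ[ℝ] ℝ} {C : ℝ}
    (hℓ : ∀ f : orliczSpace hφ μ, |ℓ f| ≤ C * orliczNorm φ μ f) (h𝔇 : 𝔇 ≤ mΩ)
    {ι : Type*} {l : Filter ι} {A : ι → Set Ω} (hA : ∀ i, MeasurableSet (A i))
    (hlim : Tendsto (fun i => μ (A i)) l (𝓝 0)) :
    Tendsto (fun i => ℓ ⟨_, condExpPerp_indicator_mem_orliczSpace hφ h𝔇 (hA i)⟩) l (𝓝 0) := by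
  have hreal : Tendsto (fun i => 2 * μ.real (A i)) l (𝓝 0) := by
    have : Tendsto (fun i => μ.real (A i)) l (𝓝 0) :=
      (ENNReal.tendsto_toReal ENNReal.zero_ne_top).comp hlim
    simpa using this.const_mul 2
  have hL1 : Tendsto (fun i => ∫ x, |condExpPerp 𝔇 μ ((A i).indicator fun _ => (1 : ℝ)) x| ∂μ)
      l (𝓝 0) := by
    refine squeeze_zero (fun i => integral_nonneg fun _ => abs_nonneg _) (fun i => ?_) hreal
    refine (integral_abs_condExpPerp_le (integrable_indicator_one (hA i))).trans (le_of_eq ?_)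
    have : (fun x => |(A i).indicator (fun _ => (1 : ℝ)) x|) = (A i).indicator fun _ => 1 := by
      ext x
      by_cases hx : x ∈ A i <;> simp [hx]
    rw [this, integral_indicator_const _ (hA i), smul_eq_mul, mul_one]
  have hmod := tendsto_orliczModular_of_bounded hφ
    (fun i => measurable_condExpPerp h𝔇 (measurable_const.indicator (hA i)))
    (M := 2 * 1) (by norm_num) (fun i => ae_abs_condExpPerp_le (abs_indicator_one_le (A i))) hL1
  have hnorm := (tendsto_orliczNorm_zero hφ fun c =>
    (hmod c).eventually_le_const one_pos).const_mul C
  rw [mul_zero] at hnorm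
  exact squeeze_zero_norm (fun i => hℓ _) hnorm

/-- A bounded functional `ℓ` induces the signed measure `A ↦ ℓ(χ_A - E(χ_A | 𝔇))`. -/
theorem exists_signedMeasure_of_bounded {ℓ : orliczSpace hφ μ →ₗ[ℝ] ℝ} {C : ℝ}
    (hℓ : ∀ f : orliczSpace hφ μ, |ℓ f| ≤ C * orliczNorm φ μ f) (h𝔇 : 𝔇 ≤ mΩ) :
    ∃ ν : SignedMeasure Ω, ∀ (A : Set Ω) (hA : MeasurableSet A),
      ν A = ℓ ⟨_, condExpPerp_indicator_mem_orliczSpace hφ h𝔇 hA⟩ := by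
  classical
  let v : Set Ω → ℝ := fun A => if hA : MeasurableSet A then
    ℓ ⟨_, condExpPerp_indicator_mem_orliczSpace hφ h𝔇 hA⟩ else 0
  have v_apply : ∀ (A : Set Ω) (hA : MeasurableSet A),
      v A = ℓ ⟨_, condExpPerp_indicator_mem_orliczSpace hφ h𝔇 hA⟩ := fun A hA => dif_pos hA
  have v_union : ∀ A B : Set Ω, MeasurableSet A → MeasurableSet B → Disjoint A B →
      v (A ∪ B) = v A + v B := by
    intro A B hA hB hAB
    rw [v_apply _ hA, v_apply _ hB, v_apply _ (hA.union hB), ← map_add]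
    refine map_eq_of_ae_eq_of_bounded hℓ ?_
    filter_upwards [condExp_add (integrable_indicator_one (μ := μ) hA)
      (integrable_indicator_one hB) 𝔇] with x hx
    simp only [Submodule.coe_add, condExpPerp, Pi.add_apply, Pi.sub_apply] at hx ⊢
    rw [Set.indicator_union_of_disjoint hAB]
    change _ - (μ[(A.indicator fun _ => (1 : ℝ)) + (B.indicator fun _ => (1 : ℝ))|𝔇]) x = _
    rw [hx]
    ring
  have v_empty : v ∅ = 0 := by
    have := v_union ∅ ∅ .empty .empty (Set.disjoint_empty _)
    rw [Set.union_empty] at this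
    linarith
  refine ⟨⟨v, v_empty, fun A hA => dif_neg hA, fun f hf hdisj => ?_⟩, v_apply⟩
  -- The remainder of the union after finitely many of its sets.
  let R : Finset ℕ → Set Ω := fun s => (⋃ i, f i) \ ⋃ i ∈ s, f i
  have hR : ∀ s, MeasurableSet (R s) := fun s =>
    (MeasurableSet.iUnion hf).diff (s.measurableSet_biUnion fun i _ => hf i)
  have hsum : ∀ s : Finset ℕ, v (⋃ i, f i) - v (R s) = ∑ i ∈ s, v (f i) := by
    intro s
    induction s using Finset.induction_on with
    | empty => simp [R]
    | insert a s ha ih =>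
      have hunion : R s = f a ∪ R (insert a s) := by
        ext x
        simp only [R, Set.mem_sdiff, Set.mem_iUnion, Set.mem_union, Finset.mem_insert, not_exists,
          exists_prop, not_and]
        constructor
        · rintro ⟨⟨i, hi⟩, hx⟩
          by_cases hxa : x ∈ f a
          · exact Or.inl hxa
          · refine Or.inr ⟨⟨i, hi⟩, ?_⟩
            rintro j (rfl | hj)
            · exact hxa
            · exact hx j hj
        · rintro (hxa | ⟨hx, hx'⟩)
          · refine ⟨⟨a, hxa⟩, fun j hj hxj => ?_⟩
            have hne : a ≠ j := fun e => ha (e ▸ hj)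
            exact Set.disjoint_left.1 (hdisj hne) hxa hxj
          · exact ⟨hx, fun j hj => hx' j (Or.inr hj)⟩
      have hdisj' : Disjoint (f a) (R (insert a s)) := by
        refine Set.disjoint_left.2 fun x hx hx' => hx'.2 ?_
        exact Set.mem_biUnion (Finset.mem_coe.2 (Finset.mem_insert_self a s)) hx
      rw [Finset.sum_insert ha, ← ih, hunion, v_union _ _ (hf a) (hR _) hdisj']
      ring
  have hRlim : Tendsto (fun s => μ (R s)) atTop (𝓝 0) := by
    have hanti : Antitone R := fun s t hst =>
      Set.sdiff_subset_sdiff_right (Set.biUnion_subset_biUnion_left hst)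
    have := tendsto_measure_iInter_atTop (μ := μ) (fun s => (hR s).nullMeasurableSet) hanti
      ⟨∅, measure_ne_top _ _⟩
    have hempty : ⋂ s, R s = ∅ := by
      refine Set.eq_empty_of_forall_notMem fun x hx => ?_
      obtain ⟨i, hi⟩ := Set.mem_iUnion.1 (Set.mem_iInter.1 hx ∅).1
      refine (Set.mem_iInter.1 hx {i}).2 ?_
      simpa using hi
    rwa [hempty, measure_empty] at this
  have hvR : Tendsto (fun s => v (R s)) atTop (𝓝 0) := by
    simp only [fun s => v_apply _ (hR s)]
    exact tendsto_map_condExpPerp_indicator hℓ h𝔇 hR hRlim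
  have := (tendsto_const_nhds (x := v (⋃ i, f i)) (f := atTop)).sub hvR
  rw [sub_zero] at this
  exact this.congr hsum

/-- The signed measure `A ↦ ℓ(χ_A - E(χ_A | 𝔇))` vanishes on `𝔇` and has a density `g` with respect
to `μ`, so that `E(g | 𝔇) = 0`; its value at `A ∈ 𝒜 n` is `∫_A E(g | 𝒜 n) dμ`, which is at most the
`L¹`-distance between `E(g | 𝒜 n)` and `E(g | 𝔇)`. -/
theorem perpConverges_of_tendsto_condExpL1Dist (h𝒜 : ∀ n, 𝒜 n ≤ mΩ) (h𝔇 : 𝔇 ≤ mΩ)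
    (h : ∀ f : Ω → ℝ, Measurable f → Integrable f μ →
      Tendsto (fun n => condExpL1Dist (𝒜 n) 𝔇 μ f) atTop (𝓝 0)) :
    PerpConverges 𝒜 𝔇 hφ μ := by
  intro A hA
  refine ⟨fun n => condExpPerp_indicator_mem_orliczSpace hφ h𝔇 (h𝒜 n _ (hA n)),
    Submodule.zero_mem _, ?_⟩
  rintro ℓ ⟨C, hℓ⟩
  have hzero : ℓ ⟨0, Submodule.zero_mem _⟩ = 0 := map_zero ℓ
  rw [hzero]
  obtain ⟨ν, hν⟩ := exists_signedMeasure_of_bounded hℓ h𝔇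
  have map_zero_of_ae : ∀ B (hB : MeasurableSet B),
      condExpPerp 𝔇 μ (B.indicator fun _ => (1 : ℝ)) =ᵐ[μ] 0 → ν B = 0 := fun B hB h0 => by
    rw [hν B hB, map_eq_of_ae_eq_of_bounded hℓ (g := 0) h0, map_zero]
  have hac : ν ≪ᵥ μ.toENNRealVectorMeasure := by
    refine VectorMeasure.AbsolutelyContinuous.mk fun B hB hμB => map_zero_of_ae B hB ?_
    rw [Measure.toENNRealVectorMeasure_apply_measurable hB] at hμB
    have h0 : B.indicator (fun _ => (1 : ℝ)) =ᵐ[μ] 0 := indicator_meas_zero hμB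
    filter_upwards [h0, condExp_congr_ae (m := 𝔇) h0] with x hx hx'
    simp [condExpPerp, hx, hx', condExp_zero]
  set g := ν.rnDeriv μ
  have hg : Integrable g μ := SignedMeasure.integrable_rnDeriv ν μ
  have hνg : ∀ B, MeasurableSet B → ν B = ∫ x in B, g x ∂μ := fun B hB => by
    rw [← withDensityᵥ_apply hg hB, SignedMeasure.withDensityᵥ_rnDeriv_eq ν μ hac]
  have hg0 : (0 : Ω → ℝ) =ᵐ[μ] μ[g|𝔇] := by
    refine ae_eq_condExp_of_forall_setIntegral_eq h𝔇 hg
      (fun _ _ _ => integrableOn_zero) (fun D hD _ => ?_) aestronglyMeasurable_zero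
    have : condExpPerp 𝔇 μ (D.indicator fun _ => (1 : ℝ)) = 0 := by
      rw [condExpPerp, condExp_of_stronglyMeasurable h𝔇 (stronglyMeasurable_const.indicator hD)
        (integrable_indicator_one (h𝔇 _ hD)), sub_self]
    rw [← hνg D (h𝔇 _ hD), map_zero_of_ae D (h𝔇 _ hD) (by rw [this])]
    simp
  refine squeeze_zero_norm (fun n => ?_) (h g (SignedMeasure.measurable_rnDeriv ν μ) hg)
  rw [← hν _ (h𝒜 n _ (hA n)), hνg _ (h𝒜 n _ (hA n)), ← setIntegral_condExp (h𝒜 n) hg (hA n),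
    condExpL1Dist]
  calc ‖∫ x in A n, (μ[g|𝒜 n]) x ∂μ‖ ≤ ∫ x in A n, |(μ[g|𝒜 n]) x| ∂μ :=
        norm_integral_le_integral_norm _
    _ ≤ ∫ x, |(μ[g|𝒜 n]) x| ∂μ := setIntegral_le_integral integrable_condExp.abs
        (Eventually.of_forall fun _ => abs_nonneg _)
    _ = ∫ x, |(μ[g|𝒜 n]) x - (μ[g|𝔇]) x| ∂μ := by
        refine integral_congr_ae ?_
        filter_upwards [hg0] with x hx
        rw [← hx, Pi.zero_apply, sub_zero]

end Converse

/-! ### Convergence in the Orlicz norm -/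

section Norm

variable {Ω : Type*} {𝒜 : ℕ → MeasurableSpace Ω} {𝔇 : MeasurableSpace Ω}
  [mΩ : MeasurableSpace Ω] {μ : Measure Ω} [IsFiniteMeasure μ] {φ : ℝ → ℝ}
  {hφ : IsYoungFunction φ}

theorem tendsto_condExpL1Dist_of_orliczTendsto
    (h : ∀ f ∈ orliczSpace hφ μ, OrliczTendsto hφ μ (fun n => μ[f|𝒜 n]) (μ[f|𝔇]))
    {f : Ω → ℝ} (hf : Measurable f) (hint : Integrable f μ) :
    Tendsto (fun n => condExpL1Dist (𝒜 n) 𝔇 μ f) atTop (𝓝 0) := by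
  refine tendsto_condExpL1Dist_of_forall_bounded (fun g M hg hM => ?_) hf hint
  obtain ⟨C, hC⟩ := exists_integral_abs_le_mul_orliczNorm hφ μ
  obtain ⟨hu, hv, hlim⟩ := h g (mem_orliczSpace_of_bounded hφ hg (Eventually.of_forall hM))
  exact squeeze_zero (fun n => condExpL1Dist_nonneg _)
    (fun n => (hC _ (Submodule.sub_mem _ (hu n) hv)).2) (by simpa using hlim.const_mul C)

/-- Split `f` into a bounded part, for which `L¹`-convergence suffices, and a remainder of small
modular, which by Jensen's inequality stays small under conditional expectations. -/
theorem orliczTendsto_condExp (hΔ : SatisfiesDeltaTwo φ) (h𝒜 : ∀ n, 𝒜 n ≤ mΩ) (h𝔇 : 𝔇 ≤ mΩ)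
    (h : ∀ f : Ω → ℝ, Measurable f → Integrable f μ →
      Tendsto (fun n => condExpL1Dist (𝒜 n) 𝔇 μ f) atTop (𝓝 0))
    {f : Ω → ℝ} (hf : f ∈ orliczSpace hφ μ) :
    OrliczTendsto hφ μ (fun n => μ[f|𝒜 n]) (μ[f|𝔇]) := by
  refine ⟨fun n => condExp_mem_orliczSpace (h𝒜 n) hf, condExp_mem_orliczSpace h𝔇 hf,
    tendsto_orliczNorm_zero hφ fun c => ?_⟩
  have hthird : (0 : ENNReal) < 3⁻¹ := ENNReal.inv_pos.2 (by simp)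
  obtain ⟨g, M, hg, hM, hfg⟩ := exists_bounded_orliczModular_sub_lt hΔ hf (3 * c) hthird
  have hfint := integrable_of_mem_orliczSpace hf
  have hgint : Integrable g μ := .of_bound hg.aestronglyMeasurable M (Eventually.of_forall hM)
  have hmeas : ∀ (m : MeasurableSpace Ω) (hm : m ≤ mΩ) (u : Ω → ℝ), Measurable[mΩ] (μ[u|m]) :=
    fun m hm u => (stronglyMeasurable_condExp.mono hm).measurable
  have hbdd : ∀ n, ∀ᵐ x ∂μ, |(μ[g|𝒜 n] - μ[g|𝔇]) x| ≤ 2 * max M 1 := fun n => by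
    filter_upwards [ae_bdd_abs_condExp_of_ae_bdd_abs (m := 𝒜 n) (μ := μ) (Eventually.of_forall hM),
      ae_bdd_abs_condExp_of_ae_bdd_abs (m := 𝔇) (μ := μ) (Eventually.of_forall hM)] with x h₁ h₂
    rw [Pi.sub_apply]
    linarith [abs_sub ((μ[g|𝒜 n]) x) ((μ[g|𝔇]) x), le_max_left M 1]
  have hmid := tendsto_orliczModular_of_bounded hφ
    (fun n => (hmeas _ (h𝒜 n) g).sub (hmeas _ h𝔇 g)) (by positivity) hbdd (h g hg hgint) (3 * c)
  filter_upwards [hmid.eventually_le_const hthird] with n hn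
  have h₁ : orliczModular φ μ ((3 * c) • μ[f - g|𝒜 n]) ≤ 3⁻¹ :=
    (orliczModular_condExp_le hφ (h𝒜 n) (hfint.sub hgint) _).trans hfg.le
  have h₂ : orliczModular φ μ ((-(3 * c)) • μ[f - g|𝔇]) ≤ 3⁻¹ := by
    have : orliczModular φ μ ((-(3 * c)) • μ[f - g|𝔇]) =
        orliczModular φ μ ((3 * c) • μ[f - g|𝔇]) :=
      lintegral_congr fun x => by
        rw [neg_smul, Pi.neg_apply, hφ.even]
    rw [this]
    exact (orliczModular_condExp_le hφ h𝔇 (hfint.sub hgint) _).trans hfg.le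
  calc orliczModular φ μ (c • (μ[f|𝒜 n] - μ[f|𝔇]))
      ≤ ∫⁻ x, (ENNReal.ofReal (φ (((3 * c) • μ[f - g|𝒜 n]) x)) +
          ENNReal.ofReal (φ (((3 * c) • (μ[g|𝒜 n] - μ[g|𝔇])) x)) +
          ENNReal.ofReal (φ (((-(3 * c)) • μ[f - g|𝔇]) x))) ∂μ := by
        refine lintegral_mono_ae ?_
        filter_upwards [condExp_sub hfint hgint (𝒜 n), condExp_sub hfint hgint 𝔇] with x hx hx'
        rw [← ENNReal.ofReal_add (hφ.nonneg _) (hφ.nonneg _),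
          ← ENNReal.ofReal_add (add_nonneg (hφ.nonneg _) (hφ.nonneg _)) (hφ.nonneg _)]
        apply ENNReal.ofReal_le_ofReal
        have := hφ.map_add_add_le (c * ((μ[f|𝒜 n]) x - (μ[g|𝒜 n]) x))
          (c * ((μ[g|𝒜 n]) x - (μ[g|𝔇]) x)) (-c * ((μ[f|𝔇]) x - (μ[g|𝔇]) x))
        simp only [Pi.smul_apply, Pi.sub_apply, smul_eq_mul, hx, hx']
        refine le_trans (le_of_eq ?_) (this.trans (le_of_eq ?_))
        · congr 1
          ring
        · simp only [neg_mul, mul_neg, mul_assoc]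
    _ = orliczModular φ μ ((3 * c) • μ[f - g|𝒜 n]) +
          orliczModular φ μ ((3 * c) • (μ[g|𝒜 n] - μ[g|𝔇])) +
          orliczModular φ μ ((-(3 * c)) • μ[f - g|𝔇]) := by
        have m₁ := hφ.measurable_ofReal_comp ((hmeas _ (h𝒜 n) (f - g)).const_smul (3 * c))
        have m₂ := hφ.measurable_ofReal_comp
          (((hmeas _ (h𝒜 n) g).sub (hmeas _ h𝔇 g)).const_smul (3 * c))
        rw [lintegral_add_left (by exact m₁.add m₂), lintegral_add_left m₁]
        rfl
    _ ≤ 3⁻¹ + 3⁻¹ + 3⁻¹ := add_le_add (add_le_add h₁ hn) h₂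
    _ = 1 := ENNReal.inv_three_add_inv_three

end Norm

theorem theorem4p5 {Ω : Type*} (𝒜 : ℕ → MeasurableSpace Ω) (𝔇 : MeasurableSpace Ω)
    [mΩ : MeasurableSpace Ω] (h𝒜 : ∀ n, 𝒜 n ≤ mΩ) (h𝔇 : 𝔇 ≤ mΩ)
    (μ : Measure Ω) [IsFiniteMeasure μ]
    (φ : ℝ → ℝ) (hφ : IsYoungFunction φ) (hΔ : SatisfiesDeltaTwo φ) :
    MuPerpConverges 𝒜 𝔇 hφ μ ↔
      ∀ f ∈ orliczSpace hφ μ, OrliczTendsto hφ μ (fun n => μ[f|𝒜 n]) (μ[f|𝔇]) := by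
  refine ⟨fun h f hf => orliczTendsto_condExp hΔ h𝒜 h𝔇
    (fun g hg hint => h.tendsto_condExpL1Dist h𝒜 h𝔇 hg hint) hf, fun h => ?_⟩
  have hL1 : ∀ g : Ω → ℝ, Measurable g → Integrable g μ →
      Tendsto (fun n => condExpL1Dist (𝒜 n) 𝔇 μ g) atTop (𝓝 0) :=
    fun g hg hint => tendsto_condExpL1Dist_of_orliczTendsto h hg hint
  exact ⟨muConverges_of_tendsto_condExpL1Dist h𝔇 hL1,
    perpConverges_of_tendsto_condExpL1Dist h𝒜 h𝔇 hL1⟩
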